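/- **Proposition.** *Notation.* Let $\text{QSym}$ be the ring of quasisymmetric functions over $\mathbb{Q}$ in the variables $x_1,x_2,\dots$, let $\text{QSym}_d$ be its homogeneous component of degree $d$, and let $\mathfrak m=\bigoplus_{d\ge 1}\text{QSym}_d$. For a composition $\alpha=(\alpha_1,\dots,\alpha_k)$ of $n$ let $L_\alpha=\sum_{\beta}\sum_{i_1<\cdots<i_{\ell(\beta)}}x_{i_1}^{\beta_1}\cdots x_{i_{\ell(\beta)}}^{\beta_{\ell(\beta)}}$, where $\beta$ ranges over the refinements of $\alpha$. For a poset $P$ on $n$ elements labeled by distinct positive integers let $F(P)=\sum_{\pi}L_{C(\pi)}$, where $\pi$ ranges over the linear extensions of $P$, written as words in the labels, and $C(\pi)$ is the composition formed by the lengths of the successive increasing runs of $\pi$. For a matroid $M$ on $[n]=\{1,\dots,n\}$ let $$F(M)=\sum_{B}F(P_B),\qquad Q(M)=\mathrm{conv}\Big\{\sum_{i\in B}e_i : B\text{ a base of }M\Big\}\subset\mathbb{R}^n,$$ where $B$ ranges over the bases of $M$, and $P_B$ is the poset on $[n]$ in which $e<e'$ if and only if $e\in B$, $e'\notin B$ and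 $(B\setminus\{e\})\cup\{e'\}$ is a base, with a strict labeling (that is, $e<e'$ in $P_B$ implies that the label of $e$ is larger than the label of $e'$; we label the elements of $[n]\setminus B$ in increasing order by smaller labels than the elements of $B$, also in increasing order). For a composition $\lambda$ of $n$ with at least two parts let $M_\lambda$ be the loopless rank two matroid on $[n]$ whose parallel classes are the consecutive intervals of sizes $\lambda_1,\lambda_2,\dots$; its bases are the two-element sets that meet each interval in at most one element. Equality $Q(M)=Q(M_1)\cup Q(M_2)$ is called a *split* of matroid base polytopes if the common bases of $M_1$ and $M_2$ are the bases of a matroid $M_1\cap M_2$ on $[n]$, and $Q(M_1)\cap Q(M_2)=Q(M_1\cap M_2)$ is a (not necessarily proper) face of both $Q(M_1)$ and $Q(M_2)$. *Statement.* Let $\lambda=(\lambda_1,\dots,\lambda_t)$ be a composition of $n$ with at least two parts, let $1\le s<t$, $a=\sum_{i=1}^{s}\lambda_i$ and $b=\sum_{i=s+1}^{t}\lambda_i$, and consider the compositions $$\alpha=(a,\lambda_{s+1},\dots,\lambda_t),\qquad \beta=(\lambda_1,\dots,\lambda_s,b),\qquad \mu=(a,b)$$ of $n$. Then $$F(M_\lambda)=F(M_\alpha)+F(M_\beta)-F(M_\mu),$$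 in the quotient $\text{QSym}/\mathfrak m^2$ one has $$\overline{F(M_\lambda)}=\overline{F(M_\alpha)}+\overline{F(M_\beta)},$$ and $Q(M_\lambda)=Q(M_\alpha)\cup Q(M_\beta)$ is a split of matroid base polytopes. -/

import Mathlib

/-! ### Quasisymmetric functions over `ℚ` in the variables `x₁, x₂, …` indexed by `ℕ+` -/

/-- A power series is a quasisymmetric function if its degree is bounded and, for all
`i₁ < ⋯ < iₖ`, all `j₁ < ⋯ < jₖ` and all exponents `a₁, …, aₖ`, the monomials
`x_{i₁}^{a₁} ⋯ x_{iₖ}^{aₖ}` and `x_{j₁}^{a₁} ⋯ x_{jₖ}^{aₖ}` have the same coefficient. -/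
def IsQuasisymmetric (f : MvPowerSeries ℕ+ ℚ) : Prop :=
  (∃ N : ℕ, ∀ d : ℕ+ →₀ ℕ, MvPowerSeries.coeff d f ≠ 0 → d.degree ≤ N) ∧
  ∀ (k : ℕ) (i j : Fin k ↪o ℕ+) (a : Fin k →₀ ℕ),
    MvPowerSeries.coeff (a.embDomain i.toEmbedding) f =
      MvPowerSeries.coeff (a.embDomain j.toEmbedding) f

theorem IsQuasisymmetric.add {f g : MvPowerSeries ℕ+ ℚ}
    (hf : IsQuasisymmetric f) (hg : IsQuasisymmetric g) : IsQuasisymmetric (f + g) := by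
  obtain ⟨⟨N, hN⟩, hf⟩ := hf
  obtain ⟨⟨K, hK⟩, hg⟩ := hg
  refine ⟨⟨max N K, fun d hd => ?_⟩, fun k i j a => ?_⟩
  · by_cases h : MvPowerSeries.coeff d f = 0
    · have h' : MvPowerSeries.coeff d g ≠ 0 := by
        intro h'
        exact hd (by rw [map_add, h, h', add_zero])
      exact (hK d h').trans (le_max_right _ _)
    · exact (hN d h).trans (le_max_left _ _)
  · rw [map_add, map_add, hf k i j a, hg k i j a]

theorem IsQuasisymmetric.mul {f g : MvPowerSeries ℕ+ ℚ}
    (hf : IsQuasisymmetric f) (hg : IsQuasisymmetric g) : IsQuasisymmetric (f * g) := by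
  classical
  obtain ⟨⟨N, hN⟩, hf⟩ := hf
  obtain ⟨⟨K, hK⟩, hg⟩ := hg
  refine ⟨⟨N + K, fun d hd => ?_⟩, fun k i j a => ?_⟩
  · rw [MvPowerSeries.coeff_mul] at hd
    obtain ⟨p, hp, hne⟩ := Finset.exists_ne_zero_of_sum_ne_zero hd
    rw [Finset.HasAntidiagonal.mem_antidiagonal] at hp
    rw [← hp, map_add]
    exact add_le_add (hN _ (left_ne_zero_of_mul hne)) (hK _ (right_ne_zero_of_mul hne))
  · have key : ∀ e : Fin k ↪o ℕ+,
        MvPowerSeries.coeff (a.embDomain e.toEmbedding) (f * g) =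
          ∑ p ∈ Finset.HasAntidiagonal.antidiagonal a,
            MvPowerSeries.coeff (p.1.embDomain e.toEmbedding) f *
              MvPowerSeries.coeff (p.2.embDomain e.toEmbedding) g := by
      intro e
      rw [MvPowerSeries.coeff_mul, ← Finsupp.image_prodMap_embDomain_antidiagonal,
        Finset.sum_image]
      · rfl
      · intro p _ q _ h
        have h1 := congrArg Prod.fst h
        have h2 := congrArg Prod.snd h
        exact Prod.ext (Finsupp.embDomain_injective _ h1) (Finsupp.embDomain_injective _ h2)
    rw [key i, key j]
    exact Finset.sum_congr rfl fun p _ => by rw [hf k i j p.1, hg k i j p.2]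

theorem IsQuasisymmetric.algebraMap (r : ℚ) :
    IsQuasisymmetric (algebraMap ℚ (MvPowerSeries ℕ+ ℚ) r) := by
  classical
  rw [MvPowerSeries.algebraMap_apply]
  refine ⟨⟨0, fun d hd => ?_⟩, fun k i j a => ?_⟩
  · rw [MvPowerSeries.coeff_C] at hd
    have : d = 0 := by
      by_contra h
      simp [h] at hd
    simp [this]
  · simp only [MvPowerSeries.coeff_C, Finsupp.embDomain_eq_zero]

/-- The algebra of quasisymmetric functions, as a subalgebra of `ℚ[[x₁, x₂, …]]`. -/
noncomputable def QSym : Subalgebra ℚ (MvPowerSeries ℕ+ ℚ) where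
  carrier := {f | IsQuasisymmetric f}
  mul_mem' := IsQuasisymmetric.mul
  add_mem' := IsQuasisymmetric.add
  algebraMap_mem' := IsQuasisymmetric.algebraMap

/-- `f` lies in the homogeneous component `QSym_d`: only monomials of degree `d` occur in `f`. -/
def QSym.IsHomogeneous (f : QSym) (d : ℕ) : Prop :=
  ∀ m : ℕ+ →₀ ℕ, MvPowerSeries.coeff m (f : MvPowerSeries ℕ+ ℚ) ≠ 0 → m.degree = d

/-- The ideal `𝔪 = ⨁_{d ≥ 1} QSym_d`, written as the ideal generated by the homogeneous
quasisymmetric functions of positive degree. -/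
noncomputable def QSym.maxIdeal : Ideal QSym :=
  Ideal.span {f : QSym | ∃ d : ℕ, 1 ≤ d ∧ QSym.IsHomogeneous f d}

/-- The list of nonzero exponents of a monomial `x^d`, in increasing order of the variables. -/
def exponentList (d : ℕ+ →₀ ℕ) : List ℕ := (d.support.sort (· ≤ ·)).map d

/-- The power series `∑_{i₁ < ⋯ < iₖ} x_{i₁}^{α₁} ⋯ x_{iₖ}^{αₖ}`: the sum of all monomials whose
nonzero exponents, read in increasing order of the variables, are `α₁, …, αₖ`. -/
noncomputable def monomialSeries {n : ℕ} (α : Composition n) : MvPowerSeries ℕ+ ℚ :=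
  fun d => if exponentList d = α.blocks then 1 else 0

theorem exponentList_embDomain {k : ℕ} (i : Fin k ↪o ℕ+) (a : Fin k →₀ ℕ) :
    exponentList (a.embDomain i.toEmbedding) = (a.support.sort (· ≤ ·)).map a := by
  unfold exponentList
  rw [Finsupp.support_embDomain, ← Finset.map_sort (r := (· ≤ ·)), List.map_map]
  · exact List.map_congr_left fun x _ => Finsupp.embDomain_apply_self _ _ _
  · intro x _ y _
    exact i.le_iff_le.symm

theorem exponentList_sum (d : ℕ+ →₀ ℕ) : (exponentList d).sum = d.degree := by
  rw [Finsupp.degree_apply, Finset.sum, exponentList]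
  conv_rhs => rw [← Finset.sort_eq d.support (· ≤ ·)]
  rw [Multiset.map_coe, Multiset.sum_coe]

theorem monomialSeries_isQuasisymmetric {n : ℕ} (α : Composition n) :
    IsQuasisymmetric (monomialSeries α) := by
  refine ⟨⟨n, fun d hd => ?_⟩, fun k i j a => ?_⟩
  · have h : exponentList d = α.blocks := by
      by_contra h
      exact hd (if_neg h)
    rw [← exponentList_sum, h, α.blocks_sum]
  · change (if exponentList _ = α.blocks then (1 : ℚ) else 0) =
      if exponentList _ = α.blocks then (1 : ℚ) else 0
    rw [exponentList_embDomain, exponentList_embDomain]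

/-- The monomial quasisymmetric function indexed by `α`. -/
noncomputable def monomialQSym {n : ℕ} (α : Composition n) : QSym :=
  ⟨monomialSeries α, monomialSeries_isQuasisymmetric α⟩

/-- The fundamental quasisymmetric function `L_α`, the sum of the monomial quasisymmetric functions
over all refinements `β` of `α`. -/
noncomputable def fundamentalQSym {n : ℕ} (α : Composition n) : QSym :=
  ∑ β : Composition n with α.boundaries ⊆ β.boundaries, monomialQSym β

/-! ### The quasisymmetric function of a labeled poset -/

/-- A partial order (given by its strict order) on `n` elements, with distinct positive integers
as labels. -/
structure LabeledPoset (n : ℕ) where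
  lt : Fin n → Fin n → Prop
  irrefl : ∀ x, ¬ lt x x
  trans : ∀ x y z, lt x y → lt y z → lt x z
  label : Fin n → ℕ+
  label_injective : Function.Injective label

/-- The composition of `n` formed by the lengths of the successive increasing runs of a word `w`
of length `n`: a new run starts exactly at the positions `k` with `w (k - 1) > w k`. -/
def runComposition {n : ℕ} (w : Fin n → ℕ+) : Composition n :=
  CompositionAsSet.toComposition
    { boundaries := {k : Fin (n + 1) | k = 0 ∨ k = Fin.last n ∨
        ∃ i j : Fin n, (i : ℕ) + 1 = k ∧ (j : ℕ) = k ∧ w j < w i}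
      zero_mem := by simp
      getLast_mem := by simp }

/-- The linear extensions of `P`. The permutation `π` lists the elements of `P` in the order
`π 0, π 1, …`. -/
def LabeledPoset.IsLinearExtension {n : ℕ} (P : LabeledPoset n) (π : Equiv.Perm (Fin n)) : Prop :=
  ∀ x y, P.lt x y → π.symm x < π.symm y

open Classical in
/-- The quasisymmetric function `F(P) = ∑_π L_{C(π)}`, the sum being over the linear extensions of
`P`, written as words in the labels. -/
noncomputable def LabeledPoset.qsym {n : ℕ} (P : LabeledPoset n) : QSym :=
  ∑ π : Equiv.Perm (Fin n) with P.IsLinearExtension π,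
    fundamentalQSym (runComposition fun k => P.label (π k))

/-! ### The quasisymmetric function and the base polytope of a matroid -/

/-- The labeled poset `P_B` of a base `B` of a matroid: `e < e'` if and only if `e ∈ B`, `e' ∉ B`
and `(B - e) ∪ {e'}` is a base. Cobase elements carry the labels `1, …, n` and base elements larger
labels, so that the labeling is strict. -/
def Matroid.basePoset {n : ℕ} (M : Matroid (Fin n)) (B : Finset (Fin n)) : LabeledPoset n where
  lt e e' := e ∈ B ∧ e' ∉ B ∧ M.IsBase (((B.erase e) ∪ {e'} : Finset (Fin n)) : Set (Fin n))
  irrefl _ h := h.2.1 h.1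
  trans _ _ _ h h' := absurd h'.1 h.2.1
  label e := if e ∈ B then Nat.succPNat (n + e) else Nat.succPNat e
  label_injective := by
    intro x y h
    apply Fin.ext
    have hx := x.isLt
    have hy := y.isLt
    have h' : ((if x ∈ B then Nat.succPNat (n + x) else Nat.succPNat x : ℕ+) : ℕ) =
        (if y ∈ B then Nat.succPNat (n + y) else Nat.succPNat y : ℕ+) := congrArg PNat.val h
    split_ifs at h' <;> simp only [Nat.succPNat_coe] at h' <;> omega

theorem Matroid.basePoset_strict {n : ℕ} (M : Matroid (Fin n)) (B : Finset (Fin n)) (x y : Fin n)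
    (h : (M.basePoset B).lt x y) : (M.basePoset B).label y < (M.basePoset B).label x := by
  obtain ⟨hx, hy, -⟩ := h
  have := y.isLt
  rw [← PNat.coe_lt_coe]
  simp only [Matroid.basePoset, if_pos hx, if_neg hy, Nat.succPNat_coe]
  omega

open Classical in
/-- The quasisymmetric function `F(M) = ∑_B F(P_B)` of a matroid whose ground set is the whole of
`Fin n`. -/
noncomputable def Matroid.qsym {n : ℕ} (M : Matroid (Fin n)) : QSym :=
  ∑ B ∈ Finset.univ.filter (fun B : Finset (Fin n) => M.IsBase (B : Set (Fin n))),
    (M.basePoset B).qsym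

/-- The matroid base polytope `Q(M) ⊆ ℝⁿ`: the convex hull of the vectors `∑_{i ∈ B} e_i`, for the
bases `B` of `M`. -/
def Matroid.basePolytope {n : ℕ} (M : Matroid (Fin n)) : Set (Fin n → ℝ) :=
  convexHull ℝ {v | ∃ B : Set (Fin n), M.IsBase B ∧ v = B.indicator 1}

/-- `Q(M) = Q(M₁) ∪ Q(M₂)` is a split of matroid base polytopes: the bases common to `M₁` and `M₂`
are the bases of a matroid `M₁ ∩ M₂`, and `Q(M₁) ∩ Q(M₂) = Q(M₁ ∩ M₂)` is a face of both `Q(M₁)`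
and `Q(M₂)`. A face is the set of maximizers of a linear functional. -/
def Matroid.IsSplit {n : ℕ} (M M₁ M₂ : Matroid (Fin n)) : Prop :=
  M.basePolytope = M₁.basePolytope ∪ M₂.basePolytope ∧
  ∃ N : Matroid (Fin n), N.E = Set.univ ∧ (∀ B, N.IsBase B ↔ M₁.IsBase B ∧ M₂.IsBase B) ∧
    M₁.basePolytope ∩ M₂.basePolytope = N.basePolytope ∧
    IsExposed ℝ M₁.basePolytope N.basePolytope ∧
    IsExposed ℝ M₂.basePolytope N.basePolytope

/-! ### The loopless rank two matroids -/

/-- The matroid `M_λ` on `Fin n` for a composition `λ` of `n`: a set is independent if and only if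
it has at most two elements, and at most one in each of the consecutive intervals of sizes
`λ₁, λ₂, …`. If `λ` has at least two parts, then this is the loopless matroid of rank two
whose parallel classes are these intervals. -/
def rankTwoMatroid {n : ℕ} (lam : Composition n) : Matroid (Fin n) :=
  (IndepMatroid.ofFinite (E := Set.univ) Set.finite_univ
    (fun I => I.ncard ≤ 2 ∧ Set.InjOn lam.index I)
    (by simp)
    (fun I J hJ hIJ => ⟨(Set.ncard_le_ncard hIJ J.toFinite).trans hJ.1, hJ.2.mono hIJ⟩)
    (by
      intro I J hI hJ hlt
      have hcard : (lam.index '' I).ncard < (lam.index '' J).ncard := by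
        rwa [hI.2.ncard_image, hJ.2.ncard_image]
      obtain ⟨_, ⟨e, heJ, rfl⟩, he⟩ :=
        Set.exists_mem_notMem_of_ncard_lt_ncard hcard (Set.toFinite _)
      have heI : e ∉ I := fun h => he (Set.mem_image_of_mem _ h)
      refine ⟨e, heJ, heI, ?_, (Set.injOn_insert heI).2 ⟨hI.2, he⟩⟩
      rw [Set.ncard_insert_of_notMem heI I.toFinite]
      exact (Nat.succ_le_of_lt hlt).trans hJ.1)
    (fun I _ => Set.subset_univ I)).matroid

/-! ### Parts of a composition -/

theorem Composition.index_lt_index_iff {n : ℕ} (c : Composition n) (x y : Fin n) :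
    c.index x < c.index y ↔ ∃ k, (x : ℕ) < c.sizeUpTo k ∧ c.sizeUpTo k ≤ y := by
  constructor
  · intro h
    exact ⟨c.index y, (c.lt_sizeUpTo_index_succ x).trans_le (c.monotone_sizeUpTo h),
      c.sizeUpTo_index_le y⟩
  · rintro ⟨k, hx, hy⟩
    by_contra! h
    rcases le_total k (c.index y) with hk | hk
    · have := c.monotone_sizeUpTo (hk.trans h)
      have := c.sizeUpTo_index_le x
      omega
    · rcases hk.eq_or_lt with rfl | hk
      · have := c.monotone_sizeUpTo (show (c.index y : ℕ) ≤ c.index x from h)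
        have := c.sizeUpTo_index_le x
        omega
      · have := c.monotone_sizeUpTo (Nat.succ_le_of_lt hk)
        have := c.lt_sizeUpTo_index_succ y
        simp only [Nat.succ_eq_add_one, Fin.val_succ] at *
        omega

theorem Composition.index_monotone {n : ℕ} (c : Composition n) : Monotone c.index := by
  intro x y hxy
  by_contra! h
  obtain ⟨k, hk, hk'⟩ := (c.index_lt_index_iff y x).1 h
  have : (x : ℕ) ≤ y := hxy
  omega

theorem Composition.index_ne_iff {n : ℕ} (c : Composition n) {x y : Fin n} (hxy : x < y) :
    c.index x ≠ c.index y ↔ ∃ k, (x : ℕ) < c.sizeUpTo k ∧ c.sizeUpTo k ≤ y := by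
  rw [← c.index_lt_index_iff]
  exact ⟨fun h => (c.index_monotone hxy.le).lt_of_ne h, ne_of_lt⟩

theorem Composition.card_filter_index {n : ℕ} (c : Composition n) (k : Fin c.length) :
    (Finset.univ.filter fun i => c.index i = k).card = c.blocksFun k := by
  have : (Finset.univ.filter fun i => c.index i = k) =
      Finset.univ.map (c.embedding k).toEmbedding := by
    ext i
    have := c.mem_range_embedding_iff' (j := i) (i := k)
    simp only [Set.mem_range] at this
    simp only [Finset.mem_filter, Finset.mem_univ, true_and, Finset.mem_map,
      RelEmbedding.coe_toEmbedding, this]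
    exact eq_comm
  rw [this, Finset.card_map, Finset.card_univ, Fintype.card_fin]

theorem Composition.mem_boundaries_iff {n : ℕ} (c : Composition n) (k : Fin (n + 1)) :
    k ∈ c.boundaries ↔ ∃ m, c.sizeUpTo m = k := by
  simp only [Composition.boundaries, Finset.mem_map, Finset.mem_univ, true_and]
  constructor
  · rintro ⟨m, rfl⟩
    exact ⟨m, rfl⟩
  · rintro ⟨m, hm⟩
    rcases le_or_gt m c.length with h | h
    · exact ⟨⟨m, Nat.lt_succ_of_le h⟩, Fin.ext hm⟩
    · refine ⟨Fin.last _, Fin.ext ?_⟩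
      rw [← hm, c.sizeUpTo_ofLength_le m h.le]
      exact c.sizeUpTo_length

theorem Composition.boundaries_subset_iff {n : ℕ} (c β : Composition n) :
    c.boundaries ⊆ β.boundaries ↔ ∀ i j : Fin n, (i : ℕ) + 1 = j → j.castSucc ∈ c.boundaries →
      β.index i < β.index j := by
  constructor
  · intro h i j hij hj
    obtain ⟨m, hm⟩ := (β.mem_boundaries_iff _).1 (h hj)
    rw [Fin.val_castSucc] at hm
    exact (β.index_lt_index_iff i j).2 ⟨m, by omega, by omega⟩
  · intro h k hk
    rw [β.mem_boundaries_iff]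
    rcases Nat.eq_zero_or_pos (k : ℕ) with h0 | h0
    · exact ⟨0, by simp [h0]⟩
    · rcases (Nat.lt_succ_iff.1 k.isLt).eq_or_lt with hn | hn
      · exact ⟨β.length, by simp [hn]⟩
      · obtain ⟨m, hm, hm'⟩ := (β.index_lt_index_iff _ _).1
          (h ⟨k - 1, by omega⟩ ⟨k, hn⟩ (by simp; omega) hk)
        simp only at hm hm'
        exact ⟨m, by omega⟩

/-! ### Fillings and their contents -/

/-- The exponent vector of the monomial `∏ᵢ x_{f i}`. -/
noncomputable def content {n : ℕ} (f : Fin n → ℕ+) : ℕ+ →₀ ℕ := ∑ i, Finsupp.single (f i) 1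

theorem content_apply {n : ℕ} (f : Fin n → ℕ+) (v : ℕ+) :
    content f v = (Finset.univ.filter fun i => f i = v).card := by
  rw [content, Finsupp.finsetSum_apply, Finset.card_filter]
  exact Finset.sum_congr rfl fun i _ => Finsupp.single_apply

theorem degree_content {n : ℕ} (f : Fin n → ℕ+) : (content f).degree = n := by
  simp [content, map_sum]

theorem content_comp_perm {n : ℕ} (f : Fin n → ℕ+) (σ : Equiv.Perm (Fin n)) :
    content (f ∘ σ) = content f :=
  Equiv.sum_comp σ fun i => Finsupp.single (f i) 1

theorem eq_of_monotone_of_content_eq {n : ℕ} {f g : Fin n → ℕ+} (hf : Monotone f)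
    (hg : Monotone g) (h : content f = content g) : f = g := by
  have key : ∀ (f : Fin n → ℕ+) (v : ℕ+), (List.ofFn f).count v = content f v := by
    intro f v
    rw [content_apply, List.ofFn_eq_map, ← Multiset.coe_count, ← Multiset.map_coe,
      Multiset.count_map, Finset.card_def, Finset.filter_val]
    simp only [eq_comm]
    rfl
  apply List.ofFn_injective
  refine List.Perm.eq_of_pairwise (le := (· ≤ ·)) (fun _ _ _ _ => le_antisymm) ?_ ?_
    (List.perm_iff_count.2 fun v => by rw [key, key, h])
  · exact List.pairwise_ofFn.2 fun i j hij => hf hij.le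
  · exact List.pairwise_ofFn.2 fun i j hij => hg hij.le

/-- The fillings of `n` positions by positive integers with content `d`. -/
noncomputable def fillings (n : ℕ) (d : ℕ+ →₀ ℕ) : Finset (Fin n → ℕ+) :=
  {f ∈ Fintype.piFinset fun _ => d.support | content f = d}

theorem mem_fillings {n : ℕ} {d : ℕ+ →₀ ℕ} {f : Fin n → ℕ+} :
    f ∈ fillings n d ↔ content f = d := by
  simp only [fillings, Finset.mem_filter, Fintype.mem_piFinset, and_iff_right_iff_imp]
  rintro rfl i
  rw [Finsupp.mem_support_iff, content_apply]
  exact (Finset.card_pos.2 ⟨i, by simp⟩).ne'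

/-! ### Coefficients of `L_α` and of `F(P)` -/

theorem coeff_sum_qsym {ι : Type*} (s : Finset ι) (F : ι → QSym) (d : ℕ+ →₀ ℕ) :
    MvPowerSeries.coeff d ((∑ i ∈ s, F i : QSym) : MvPowerSeries ℕ+ ℚ) =
      ∑ i ∈ s, MvPowerSeries.coeff d (F i : MvPowerSeries ℕ+ ℚ) := by
  rw [← map_sum]
  congr 1
  exact map_sum QSym.val F s

theorem coeff_monomialQSym {n : ℕ} (β : Composition n) (d : ℕ+ →₀ ℕ) :
    MvPowerSeries.coeff d (monomialQSym β : MvPowerSeries ℕ+ ℚ) =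
      if exponentList d = β.blocks then 1 else 0 := rfl

theorem coeff_fundamentalQSym_of_degree_ne {n : ℕ} (c : Composition n) {d : ℕ+ →₀ ℕ}
    (hd : d.degree ≠ n) :
    MvPowerSeries.coeff d (fundamentalQSym c : MvPowerSeries ℕ+ ℚ) = 0 := by
  rw [fundamentalQSym, coeff_sum_qsym]
  refine Finset.sum_eq_zero fun β _ => ?_
  rw [coeff_monomialQSym, if_neg]
  intro h
  exact hd (by rw [← exponentList_sum, h, β.blocks_sum])

theorem exists_monotone_content_eq {n : ℕ} {d : ℕ+ →₀ ℕ} (hd : d.degree = n) :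
    ∃ (β : Composition n) (g : Fin n → ℕ+), β.blocks = exponentList d ∧ Monotone g ∧
      content g = d ∧ ∀ i j, g i < g j ↔ β.index i < β.index j := by
  let β : Composition n := ⟨exponentList d, by
    intro i hi
    simp only [exponentList, List.mem_map, Finset.mem_sort, Finsupp.mem_support_iff] at hi
    obtain ⟨v, hv, rfl⟩ := hi
    exact Nat.pos_of_ne_zero hv, by rw [exponentList_sum, hd]⟩
  have hlen : β.length = d.support.card := by
    change (exponentList d).length = _
    simp [exponentList]
  let e : Fin β.length ↪o ℕ+ := d.support.orderEmbOfFin hlen.symm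
  have he : ∀ k, d (e k) = β.blocksFun k := by
    intro k
    change d (d.support.orderEmbOfFin hlen.symm k) = (exponentList d)[(k : ℕ)]'k.2
    simp [exponentList, Finset.orderEmbOfFin_apply]
  refine ⟨β, fun i => e (β.index i), rfl, fun i j h => e.monotone (β.index_monotone h), ?_,
    fun i j => e.lt_iff_lt⟩
  ext v
  rw [content_apply]
  by_cases hv : v ∈ d.support
  · have : v ∈ Set.range e := by
      rw [Finset.range_orderEmbOfFin]
      exact hv
    obtain ⟨k, rfl⟩ := this
    simp only [EmbeddingLike.apply_eq_iff_eq]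
    rw [β.card_filter_index, he]
  · rw [Finsupp.notMem_support_iff.1 hv, Finset.card_eq_zero, Finset.filter_eq_empty_iff]
    rintro i - rfl
    exact hv (Finset.orderEmbOfFin_mem _ _ _)

open Classical in
theorem exists_monotone_coeff_fundamentalQSym {n : ℕ} {d : ℕ+ →₀ ℕ} (hd : d.degree = n) :
    ∃ g : Fin n → ℕ+, Monotone g ∧ content g = d ∧ ∀ c : Composition n,
      MvPowerSeries.coeff d (fundamentalQSym c : MvPowerSeries ℕ+ ℚ) =
        if ∀ i j : Fin n, (i : ℕ) + 1 = j → j.castSucc ∈ c.boundaries → g i < g j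
          then 1 else 0 := by
  obtain ⟨β, g, hβ, hg, hgd, hlt⟩ := exists_monotone_content_eq hd
  refine ⟨g, hg, hgd, fun c => ?_⟩
  simp only [hlt, ← Composition.boundaries_subset_iff]
  rw [fundamentalQSym, coeff_sum_qsym]
  have : ∀ γ : Composition n, exponentList d = γ.blocks ↔ γ = β := fun γ => by
    rw [← hβ, Composition.ext_iff, eq_comm]
  simp only [coeff_monomialQSym, this, Finset.sum_ite_eq', Finset.mem_filter, Finset.mem_univ,
    true_and]

theorem castSucc_mem_boundaries_runComposition {n : ℕ} (w : Fin n → ℕ+) {i j : Fin n}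
    (hij : (i : ℕ) + 1 = j) : j.castSucc ∈ (runComposition w).boundaries ↔ w j < w i := by
  rw [runComposition, CompositionAsSet.toComposition_boundaries]
  simp only [Finset.mem_filter, Finset.mem_univ, true_and]
  constructor
  · rintro (h | h | ⟨i', j', h, h', hw⟩)
    · have := congrArg Fin.val h
      simp at this
      omega
    · have := congrArg Fin.val h
      simp at this
      omega
    · rw [Fin.val_castSucc] at h h'
      obtain rfl : j' = j := Fin.ext h'
      obtain rfl : i' = i := Fin.ext (by omega)
      exact hw
  · intro h
    exact Or.inr (Or.inr ⟨i, j, hij, rfl, h⟩)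

theorem strictMono_toLex_iff {n : ℕ} {g w : Fin n → ℕ+} (hw : Function.Injective w)
    (hg : Monotone g) :
    StrictMono (fun i => toLex (g i, w i)) ↔
      ∀ i j : Fin n, (i : ℕ) + 1 = j → w j < w i → g i < g j := by
  cases n with
  | zero => exact ⟨fun _ i => i.elim0, fun _ i => i.elim0⟩
  | succ n =>
    rw [Fin.strictMono_iff_lt_succ]
    constructor
    · intro h i j hij hlt
      have hi : (i : ℕ) < n := by omega
      have h' := h ⟨i, hi⟩
      obtain rfl : j = Fin.succ ⟨i, hi⟩ := Fin.ext (by simp [← hij])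
      rw [Prod.Lex.toLex_lt_toLex] at h'
      rcases h' with h' | h'
      · exact h'
      · exact absurd h'.2 hlt.not_gt
    · intro h i
      rw [Prod.Lex.toLex_lt_toLex]
      have hi : i.castSucc < i.succ := Fin.castSucc_lt_succ
      rcases (hg hi.le).lt_or_eq with h' | h'
      · exact Or.inl h'
      · refine Or.inr ⟨h', lt_of_not_ge fun h'' => ?_⟩
        exact (h _ _ (by simp) (h''.lt_of_ne fun e => hi.ne' (hw e))).ne h'

open Classical in
/-- The coefficients of `F(P)` count the strict `P`-partitions if the labeling of `P` is strict. -/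
theorem LabeledPoset.coeff_qsym {n : ℕ} (P : LabeledPoset n)
    (hP : ∀ x y, P.lt x y → P.label y < P.label x) (d : ℕ+ →₀ ℕ) :
    MvPowerSeries.coeff d (P.qsym : MvPowerSeries ℕ+ ℚ) =
      ((fillings n d).filter fun f => ∀ x y, P.lt x y → f x < f y).card := by
  rw [LabeledPoset.qsym, coeff_sum_qsym]
  by_cases hd : d.degree = n
  swap
  · rw [Finset.sum_eq_zero fun π _ => coeff_fundamentalQSym_of_degree_ne _ hd, eq_comm,
      Nat.cast_eq_zero, Finset.card_eq_zero, Finset.filter_eq_empty_iff]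
    intro f hf
    exact absurd ((mem_fillings.1 hf) ▸ degree_content f) hd
  obtain ⟨g, hg, hgd, hL⟩ := exists_monotone_coeff_fundamentalQSym hd
  simp only [hL, Finset.sum_boole, Finset.filter_filter]
  have hrun : ∀ π : Equiv.Perm (Fin n), (∀ i j : Fin n, (i : ℕ) + 1 = j → j.castSucc ∈
      (runComposition fun k => P.label (π k)).boundaries → g i < g j) ↔
      StrictMono fun i => toLex (g i, P.label (π i)) := by
    intro π
    rw [strictMono_toLex_iff (w := fun i => P.label (π i))
      (P.label_injective.comp π.injective) hg]
    refine forall₃_congr fun i j hij => ?_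
    rw [castSucc_mem_boundaries_runComposition _ hij]
  simp only [hrun]
  norm_cast
  let key (f : Fin n → ℕ+) (x : Fin n) : ℕ+ ×ₗ ℕ+ := toLex (f x, P.label x)
  have key_inj : ∀ f, Function.Injective (key f) := fun f x y h =>
    P.label_injective (congrArg Prod.snd (toLex.injective h))
  have sort_eq : ∀ f, content f = d → f ∘ Tuple.sort (key f) = g := by
    intro f hf
    refine eq_of_monotone_of_content_eq (fun i j hij => ?_) hg ?_
    · have h := Tuple.monotone_sort (key f) hij
      rw [Function.comp_apply, Function.comp_apply, Prod.Lex.toLex_le_toLex] at h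
      exact h.elim le_of_lt fun h => h.1.le
    · rw [content_comp_perm, hf, hgd]
  refine Finset.card_bij' (fun π _ => g ∘ π.symm) (fun f _ => Tuple.sort (key f)) ?_ ?_ ?_ ?_
  · intro π hπ
    simp only [Finset.mem_filter, Finset.mem_univ, true_and] at hπ
    rw [Finset.mem_filter, mem_fillings, content_comp_perm]
    refine ⟨hgd, fun x y hxy => ?_⟩
    have h := hπ.2 (hπ.1 x y hxy)
    simp only [Equiv.apply_symm_apply] at h
    rw [Prod.Lex.toLex_lt_toLex] at h
    exact h.resolve_right fun h => (hP x y hxy).not_gt h.2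
  · intro f hf
    rw [Finset.mem_filter, mem_fillings] at hf
    have hs := sort_eq f hf.1
    have hmono : StrictMono (key f ∘ Tuple.sort (key f)) :=
      (Tuple.monotone_sort (key f)).strictMono_of_injective
        ((key_inj f).comp (Tuple.sort (key f)).injective)
    simp only [Finset.mem_filter, Finset.mem_univ, true_and]
    constructor
    · intro x y hxy
      rw [← hmono.lt_iff_lt]
      simp only [Function.comp_apply, Equiv.apply_symm_apply, key]
      rw [Prod.Lex.toLex_lt_toLex]
      exact Or.inl (hf.2 x y hxy)
    · rw [← hs]
      exact hmono
  · intro π hπ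
    simp only [Finset.mem_filter, Finset.mem_univ, true_and] at hπ
    apply Equiv.ext
    have h1 := Tuple.monotone_sort (key (g ∘ π.symm))
    have h2 : Monotone (key (g ∘ π.symm) ∘ π) := by
      have h := hπ.2.monotone
      intro i j hij
      simpa [key] using h hij
    exact fun i => key_inj _ (congrFun (Tuple.unique_monotone h1 h2) i)
  · intro f hf
    rw [Finset.mem_filter, mem_fillings] at hf
    funext x
    simp only [Function.comp_apply]
    rw [← sort_eq f hf.1]
    simp

/-! ### Coefficients of `F(M)` -/

/-- For a base `B`, the filling `f` is a strict `P_B`-partition: every exchange that replaces an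
element of `B` increases the value of `f`. -/
def Matroid.IsStrictOn {n : ℕ} (M : Matroid (Fin n)) (f : Fin n → ℕ+) (B : Finset (Fin n)) : Prop :=
  ∀ e ∈ B, ∀ e' ∉ B, M.IsBase (((B.erase e) ∪ {e'} : Finset (Fin n)) : Set (Fin n)) → f e < f e'

open Classical in
/-- The bases `B` such that `f` is a strict `P_B`-partition. -/
noncomputable def Matroid.strictBases {n : ℕ} (M : Matroid (Fin n)) (f : Fin n → ℕ+) :
    Finset (Finset (Fin n)) :=
  {B | M.IsBase (B : Set (Fin n)) ∧ M.IsStrictOn f B}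

theorem Matroid.mem_strictBases {n : ℕ} {M : Matroid (Fin n)} {f : Fin n → ℕ+}
    {B : Finset (Fin n)} :
    B ∈ M.strictBases f ↔ M.IsBase (B : Set (Fin n)) ∧ M.IsStrictOn f B := by
  simp [Matroid.strictBases]

theorem Matroid.coeff_qsym {n : ℕ} (M : Matroid (Fin n)) (d : ℕ+ →₀ ℕ) :
    MvPowerSeries.coeff d (M.qsym : MvPowerSeries ℕ+ ℚ) =
      ∑ f ∈ fillings n d, ((M.strictBases f).card : ℚ) := by
  classical
  rw [Matroid.qsym, coeff_sum_qsym]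
  have : ∀ B : Finset (Fin n), MvPowerSeries.coeff d ((M.basePoset B).qsym : MvPowerSeries ℕ+ ℚ) =
      ∑ f ∈ fillings n d, if M.IsStrictOn f B then 1 else 0 := by
    intro B
    rw [LabeledPoset.coeff_qsym _ (M.basePoset_strict B), Finset.sum_boole]
    congr 2
    refine Finset.filter_congr fun f _ => ?_
    exact ⟨fun h e he e' he' hb => h e e' ⟨he, he', hb⟩, fun h e e' ⟨he, he', hb⟩ =>
      h e he e' he' hb⟩
  simp only [this]
  rw [Finset.sum_comm]
  refine Finset.sum_congr rfl fun f _ => ?_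
  rw [Finset.sum_boole, Finset.filter_filter, Matroid.strictBases]

theorem Matroid.qsym_isHomogeneous {n : ℕ} (M : Matroid (Fin n)) : QSym.IsHomogeneous M.qsym n := by
  intro d hd
  rw [Matroid.coeff_qsym] at hd
  obtain ⟨f, hf, -⟩ := Finset.exists_ne_zero_of_sum_ne_zero hd
  rw [← mem_fillings.1 hf, degree_content]

theorem QSym.ext_coeff {f g : QSym} (h : ∀ d, MvPowerSeries.coeff d (f : MvPowerSeries ℕ+ ℚ) =
    MvPowerSeries.coeff d (g : MvPowerSeries ℕ+ ℚ)) : f = g :=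
  Subtype.ext (MvPowerSeries.ext h)

/-! ### Pairs of matroids split by an initial segment -/

/-- The bases of `M` are those of `M₁` and those of `M₂`, all of size two; those of `M₁` have at
most one element below `a`, those of `M₂` have at least one, and the bases of `N` are all the pairs
with exactly one. -/
structure IsPairSplit {n : ℕ} (a : ℕ) (M M₁ M₂ N : Matroid (Fin n)) : Prop where
  isBase_iff_or : ∀ B, M.IsBase B ↔ M₁.IsBase B ∨ M₂.IsBase B
  left : ∀ B, M₁.IsBase B → ∃ x y : Fin n, x < y ∧ a ≤ y ∧ B = {x, y}
  right : ∀ B, M₂.IsBase B → ∃ x y : Fin n, x < y ∧ x < a ∧ B = {x, y}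
  inter : ∀ B, N.IsBase B ↔ ∃ x y : Fin n, x < a ∧ a ≤ y ∧ B = {x, y}
  inter_left : ∀ B, N.IsBase B → M₁.IsBase B
  inter_right : ∀ B, N.IsBase B → M₂.IsBase B

theorem IsPairSplit.isBase_inter_iff {n a : ℕ} {M M₁ M₂ N : Matroid (Fin n)}
    (h : IsPairSplit a M M₁ M₂ N) (B : Set (Fin n)) :
    N.IsBase B ↔ M₁.IsBase B ∧ M₂.IsBase B := by
  refine ⟨fun hB => ⟨h.inter_left B hB, h.inter_right B hB⟩, fun ⟨h₁, h₂⟩ => ?_⟩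
  obtain ⟨x, y, hxy, hy, rfl⟩ := h.left B h₁
  obtain ⟨x', y', hxy', hx', hB⟩ := h.right _ h₂
  refine (h.inter _).2 ⟨x, y, ?_, hy, rfl⟩
  have : x' ∈ ({x, y} : Set (Fin n)) := by simp [hB]
  rcases this with rfl | rfl
  · exact hx'
  · omega

theorem Matroid.IsStrictOn.mono {n : ℕ} {M M' : Matroid (Fin n)} {f : Fin n → ℕ+}
    {B : Finset (Fin n)} (h : M.IsStrictOn f B) (hM : ∀ B, M'.IsBase B → M.IsBase B) :
    M'.IsStrictOn f B :=
  fun e he e' he' hb => h e he e' he' (hM _ hb)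

theorem Matroid.isStrictOn_pair {n : ℕ} (M : Matroid (Fin n)) (f : Fin n → ℕ+) {x y : Fin n}
    (hxy : x ≠ y) : M.IsStrictOn f {x, y} ↔
      ∀ z, z ≠ x → z ≠ y → (M.IsBase {y, z} → f x < f z) ∧ (M.IsBase {x, z} → f y < f z) := by
  have hx : ({x, y} : Finset (Fin n)).erase x = {y} := by
    ext z
    simp only [Finset.mem_erase, Finset.mem_insert, Finset.mem_singleton]
    grind
  have hy : ({x, y} : Finset (Fin n)).erase y = {x} := by
    ext z
    simp only [Finset.mem_erase, Finset.mem_insert, Finset.mem_singleton]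
    grind
  constructor
  · intro h z hzx hzy
    have hz : z ∉ ({x, y} : Finset (Fin n)) := by simp [hzx, hzy]
    refine ⟨fun hb => h x (by simp) z hz ?_, fun hb => h y (by simp) z hz ?_⟩
    · simpa [hx] using hb
    · simpa [hy] using hb
  · intro h e he z hz hb
    simp only [Finset.mem_insert, Finset.mem_singleton, not_or] at he hz
    rcases he with rfl | rfl
    · exact (h z hz.1 hz.2).1 (by simpa [hx] using hb)
    · exact (h z hz.1 hz.2).2 (by simpa [hy] using hb)

theorem IsPairSplit.strictBases_inter_subset {n a : ℕ} {M M₁ M₂ N : Matroid (Fin n)}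
    (h : IsPairSplit a M M₁ M₂ N) (f : Fin n → ℕ+) :
    N.strictBases f ⊆ M₁.strictBases f ∪ M₂.strictBases f := by
  intro B hB
  rw [Matroid.mem_strictBases] at hB
  rw [Finset.mem_union, Matroid.mem_strictBases, Matroid.mem_strictBases]
  obtain ⟨hBN, hs⟩ := hB
  obtain ⟨x, y, hx, hy, hxy⟩ := (h.inter _).1 hBN
  have hne : x ≠ y := by rintro rfl; omega
  obtain rfl : B = {x, y} := by
    rw [← Finset.coe_inj, hxy]
    simp
  by_contra hcon
  simp only [h.inter_left _ hBN, h.inter_right _ hBN, true_and, not_or] at hcon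
  rw [Matroid.isStrictOn_pair _ _ hne] at hs
  obtain ⟨h₁, h₂⟩ := hcon
  rw [Matroid.isStrictOn_pair _ _ hne] at h₁ h₂
  push Not at h₁ h₂
  obtain ⟨z, hzx, hzy, hz⟩ := h₁
  obtain ⟨w, hwx, hwy, hw⟩ := h₂
  have hN : ∀ u v : Fin n, u < a → a ≤ v → N.IsBase {u, v} ∧ N.IsBase {v, u} := fun u v hu hv =>
    ⟨(h.inter _).2 ⟨u, v, hu, hv, rfl⟩, (h.inter _).2 ⟨u, v, hu, hv, Set.pair_comm _ _⟩⟩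
  have hz' : a ≤ z ∧ f z ≤ f x := by
    by_cases hza : a ≤ z
    · refine ⟨hza, ?_⟩
      by_cases hb : M₁.IsBase {y, z} ∧ f z ≤ f x
      · exact hb.2
      · obtain ⟨h1, h2⟩ := hz fun h1 => lt_of_not_ge fun h2 => hb ⟨h1, h2⟩
        exact absurd ((hs z hzx hzy).2 (hN x z hx hza).1) h2.not_gt
    · exfalso
      have h1 := (hs z hzx hzy).1 (hN z y (not_le.1 hza) hy).2
      obtain ⟨h2, -⟩ := hz fun _ => h1
      obtain ⟨u, v, huv, hv, he⟩ := h.left _ h2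
      have : v ∈ ({x, z} : Set (Fin n)) := by simp [he]
      rcases this with rfl | rfl <;> omega
  have hw' : w < a ∧ f w ≤ f y := by
    by_cases hwa : a ≤ w
    · exfalso
      have h1 := (hs w hwx hwy).2 (hN x w hx hwa).1
      by_cases hb : M₂.IsBase {y, w}
      · obtain ⟨u, v, huv, hv, he⟩ := h.right _ hb
        have : u ∈ ({y, w} : Set (Fin n)) := by simp [he]
        rcases this with rfl | rfl <;> omega
      · obtain ⟨-, h2⟩ := hw fun h => absurd h hb
        exact h2.not_gt h1
    · refine ⟨not_le.1 hwa, (hw fun h1 => ?_).2⟩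
      exact (hs w hwx hwy).1 (hN w y (not_le.1 hwa) hy).2
  have h1 := (hs z hzx hzy).2 (hN x z hx hz'.1).1
  have h2 := (hs w hwx hwy).1 (hN w y hw'.1 hy).2
  exact absurd (((h1.trans_le hz'.2).trans h2).trans_le hw'.2) (lt_irrefl _)

theorem IsPairSplit.strictBases_left_subset {n a : ℕ} {M M₁ M₂ N : Matroid (Fin n)}
    (h : IsPairSplit a M M₁ M₂ N) (f : Fin n → ℕ+) :
    M₁.strictBases f ⊆ M.strictBases f ∪ N.strictBases f := by
  intro B hB
  rw [Matroid.mem_strictBases] at hB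
  rw [Finset.mem_union, Matroid.mem_strictBases, Matroid.mem_strictBases]
  obtain ⟨hB₁, hs⟩ := hB
  by_cases hN : N.IsBase (B : Set (Fin n))
  · exact Or.inr ⟨hN, hs.mono h.inter_left⟩
  refine Or.inl ⟨(h.isBase_iff_or _).2 (Or.inl hB₁), ?_⟩
  intro e he e' he' hb
  by_cases hb₁ : M₁.IsBase (((B.erase e) ∪ {e'} : Finset (Fin n)) : Set (Fin n))
  · exact hs e he e' he' hb₁
  exfalso
  have hb₂ := ((h.isBase_iff_or _).1 hb).resolve_left hb₁
  obtain ⟨p, q, hpq, hq, hBeq⟩ := h.left _ hB₁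
  obtain ⟨u, v, huv, hu, hD⟩ := h.right _ hb₂
  have hp : a ≤ p := not_lt.1 fun hp => hN ((h.inter _).2 ⟨p, q, hp, hq, hBeq⟩)
  have hv : v < a := not_le.1 fun hv =>
    hb₁ (h.inter_left _ ((h.inter _).2 ⟨u, v, hu, hv, hD⟩))
  obtain ⟨r, hrB, hre⟩ : ∃ r ∈ (B : Set (Fin n)), r ≠ e := by
    by_cases hpe : p = e
    · exact ⟨q, by simp [hBeq], fun hq => hpq.ne (hpe.trans hq.symm)⟩
    · exact ⟨p, by simp [hBeq], hpe⟩
  have hrD : r ∈ (((B.erase e) ∪ {e'} : Finset (Fin n)) : Set (Fin n)) := by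
    rw [Finset.mem_coe] at hrB ⊢
    simp [hrB, hre]
  rw [hBeq] at hrB
  rw [hD] at hrD
  rcases hrB with rfl | rfl <;> rcases hrD with rfl | rfl <;> omega

theorem IsPairSplit.strictBases_right_subset {n a : ℕ} {M M₁ M₂ N : Matroid (Fin n)}
    (h : IsPairSplit a M M₁ M₂ N) (f : Fin n → ℕ+) :
    M₂.strictBases f ⊆ M.strictBases f ∪ N.strictBases f := by
  intro B hB
  rw [Matroid.mem_strictBases] at hB
  rw [Finset.mem_union, Matroid.mem_strictBases, Matroid.mem_strictBases]
  obtain ⟨hB₂, hs⟩ := hB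
  by_cases hN : N.IsBase (B : Set (Fin n))
  · exact Or.inr ⟨hN, hs.mono h.inter_right⟩
  refine Or.inl ⟨(h.isBase_iff_or _).2 (Or.inr hB₂), ?_⟩
  intro e he e' he' hb
  by_cases hb₂ : M₂.IsBase (((B.erase e) ∪ {e'} : Finset (Fin n)) : Set (Fin n))
  · exact hs e he e' he' hb₂
  exfalso
  have hb₁ := ((h.isBase_iff_or _).1 hb).resolve_right hb₂
  obtain ⟨p, q, hpq, hp, hBeq⟩ := h.right _ hB₂
  obtain ⟨u, v, huv, hv, hD⟩ := h.left _ hb₁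
  have hq : q < a := not_le.1 fun hq => hN ((h.inter _).2 ⟨p, q, hp, hq, hBeq⟩)
  have hu : a ≤ u := not_lt.1 fun hu =>
    hb₂ (h.inter_right _ ((h.inter _).2 ⟨u, v, hu, hv, hD⟩))
  obtain ⟨r, hrB, hre⟩ : ∃ r ∈ (B : Set (Fin n)), r ≠ e := by
    by_cases hpe : p = e
    · exact ⟨q, by simp [hBeq], fun hq => hpq.ne (hpe.trans hq.symm)⟩
    · exact ⟨p, by simp [hBeq], hpe⟩
  have hrD : r ∈ (((B.erase e) ∪ {e'} : Finset (Fin n)) : Set (Fin n)) := by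
    rw [Finset.mem_coe] at hrB ⊢
    simp [hrB, hre]
  rw [hBeq] at hrB
  rw [hD] at hrD
  rcases hrB with rfl | rfl <;> rcases hrD with rfl | rfl <;> omega

theorem IsPairSplit.card_strictBases {n a : ℕ} {M M₁ M₂ N : Matroid (Fin n)}
    (h : IsPairSplit a M M₁ M₂ N) (f : Fin n → ℕ+) :
    (M.strictBases f).card + (N.strictBases f).card =
      (M₁.strictBases f).card + (M₂.strictBases f).card := by
  have hunion : M.strictBases f ∪ N.strictBases f = M₁.strictBases f ∪ M₂.strictBases f := by
    refine Finset.Subset.antisymm (Finset.union_subset ?_ (h.strictBases_inter_subset f))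
      (Finset.union_subset (h.strictBases_left_subset f) (h.strictBases_right_subset f))
    intro B hB
    rw [Matroid.mem_strictBases] at hB
    rw [Finset.mem_union, Matroid.mem_strictBases, Matroid.mem_strictBases]
    exact ((h.isBase_iff_or _).1 hB.1).imp
      (fun hb => ⟨hb, hB.2.mono fun B hB => (h.isBase_iff_or B).2 (Or.inl hB)⟩)
      (fun hb => ⟨hb, hB.2.mono fun B hB => (h.isBase_iff_or B).2 (Or.inr hB)⟩)
  have hinter : M.strictBases f ∩ N.strictBases f = M₁.strictBases f ∩ M₂.strictBases f := by
    ext B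
    simp only [Finset.mem_inter, Matroid.mem_strictBases]
    constructor
    · rintro ⟨⟨-, hs⟩, hN, -⟩
      exact ⟨⟨h.inter_left _ hN, hs.mono fun B hB => (h.isBase_iff_or B).2 (Or.inl hB)⟩,
        h.inter_right _ hN, hs.mono fun B hB => (h.isBase_iff_or B).2 (Or.inr hB)⟩
    · rintro ⟨⟨h₁, hs₁⟩, h₂, hs₂⟩
      exact ⟨⟨(h.isBase_iff_or _).2 (Or.inl h₁), fun e he e' he' hb =>
        ((h.isBase_iff_or _).1 hb).elim (hs₁ e he e' he') (hs₂ e he e' he')⟩,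
        (h.isBase_inter_iff _).2 ⟨h₁, h₂⟩, hs₁.mono h.inter_left⟩
  rw [← Finset.card_union_add_card_inter, hunion, hinter, Finset.card_union_add_card_inter]

theorem IsPairSplit.qsym_eq {n a : ℕ} {M M₁ M₂ N : Matroid (Fin n)}
    (h : IsPairSplit a M M₁ M₂ N) : M.qsym = M₁.qsym + M₂.qsym - N.qsym := by
  rw [eq_sub_iff_add_eq]
  apply QSym.ext_coeff
  intro d
  rw [Subalgebra.coe_add, Subalgebra.coe_add, map_add, map_add]
  simp only [Matroid.coeff_qsym, ← Finset.sum_add_distrib]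
  exact Finset.sum_congr rfl fun f _ => by exact_mod_cast h.card_strictBases f

/-! ### The sum of two matroids of rank one -/

theorem card_strictBases_of_rank_one {n : ℕ} {M : Matroid (Fin n)}
    (hM : ∀ B, M.IsBase B ↔ ∃ x, B = {x}) (f : Fin n → ℕ+) :
    (M.strictBases f).card = (Finset.univ.filter fun x => ∀ z, z ≠ x → f x < f z).card := by
  rw [← Finset.card_image_of_injective _ (Finset.singleton_injective (α := Fin n))]
  congr 1
  ext B
  simp only [Matroid.mem_strictBases, Finset.mem_image, Finset.mem_filter, Finset.mem_univ,
    true_and, hM, Matroid.IsStrictOn]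
  constructor
  · rintro ⟨⟨x, hx⟩, hs⟩
    obtain rfl : B = {x} := by
      rw [← Finset.coe_inj, hx]
      simp
    exact ⟨x, fun z hz => hs x (by simp) z (by simpa using hz) ⟨z, by simp⟩, rfl⟩
  · rintro ⟨x, hs, rfl⟩
    refine ⟨⟨x, by simp⟩, fun e he e' he' _ => ?_⟩
    rw [Finset.mem_singleton] at he he'
    subst he
    exact hs e' he'

theorem card_strictBases_of_pairs {a b : ℕ} {N : Matroid (Fin (a + b))}
    (hN : ∀ B, N.IsBase B ↔ ∃ x y : Fin (a + b), x < a ∧ a ≤ y ∧ B = {x, y})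
    (f : Fin a → ℕ+) (g : Fin b → ℕ+) :
    (N.strictBases (Fin.append f g)).card =
      (Finset.univ.filter fun x => ∀ z, z ≠ x → f x < f z).card *
      (Finset.univ.filter fun y => ∀ z, z ≠ y → g y < g z).card := by
  have hlt (x : Fin a) (y : Fin b) : Fin.castAdd b x < Fin.natAdd a y := by
    simp only [Fin.lt_def, Fin.val_castAdd, Fin.val_natAdd]
    omega
  have hpair : ∀ u v : Fin (a + b), N.IsBase {u, v} ↔ (u < a ∧ a ≤ v) ∨ (v < a ∧ a ≤ u) := by
    intro u v
    rw [hN]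
    constructor
    · rintro ⟨x, y, hx, hy, h⟩
      rw [Set.pair_eq_pair_iff] at h
      rcases h with ⟨rfl, rfl⟩ | ⟨rfl, rfl⟩
      · exact Or.inl ⟨hx, hy⟩
      · exact Or.inr ⟨hx, hy⟩
    · rintro (⟨h, h'⟩ | ⟨h, h'⟩)
      · exact ⟨u, v, h, h', rfl⟩
      · exact ⟨v, u, h, h', Set.pair_comm _ _⟩
  have hstrict : ∀ (x : Fin a) (y : Fin b),
      N.IsStrictOn (Fin.append f g) {Fin.castAdd b x, Fin.natAdd a y} ↔
        (∀ z, z ≠ x → f x < f z) ∧ ∀ z, z ≠ y → g y < g z := by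
    intro x y
    rw [Matroid.isStrictOn_pair _ _ (hlt x y).ne]
    simp only [hpair]
    constructor
    · intro h
      constructor
      · intro z hz
        have := (h (Fin.castAdd b z) (by simpa using hz) (hlt z y).ne).1 (Or.inr (by simp))
        simpa using this
      · intro z hz
        have := (h (Fin.natAdd a z) (hlt x z).ne' (by simpa using hz)).2 (Or.inl (by simp))
        simpa using this
    · rintro ⟨hx, hy⟩ z
      refine Fin.addCases (fun z => ?_) (fun z => ?_) z
      · intro hz _
        refine ⟨fun _ => by simpa using hx z (by simpa using hz), fun h => ?_⟩
        simp only [Fin.val_castAdd] at h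
        omega
      · intro _ hz
        refine ⟨fun h => ?_, fun _ => by simpa using hy z (by simpa using hz)⟩
        simp only [Fin.val_natAdd] at h
        omega
  have hinj : Function.Injective fun p : Fin a × Fin b =>
      ({Fin.castAdd b p.1, Fin.natAdd a p.2} : Finset (Fin (a + b))) := by
    rintro ⟨x, y⟩ ⟨x', y'⟩ h
    have h' := congrArg (fun s : Finset (Fin (a + b)) => (s : Set (Fin (a + b)))) h
    simp only [Finset.coe_insert, Finset.coe_singleton, Set.pair_eq_pair_iff] at h'
    rcases h' with ⟨h1, h2⟩ | ⟨h1, -⟩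
    · exact Prod.ext (by simpa using h1) (by simpa using h2)
    · exact absurd h1 (hlt x y').ne
  rw [← Finset.card_product, ← Finset.card_image_of_injective _ hinj]
  congr 1
  ext B
  simp only [Matroid.mem_strictBases, Finset.mem_image, Finset.mem_product, Finset.mem_filter,
    Finset.mem_univ, true_and, ← hstrict, Prod.exists]
  constructor
  · rintro ⟨hB, hs⟩
    obtain ⟨x, y, hx, hy, hxy⟩ := (hN _).1 hB
    obtain rfl : B = {x, y} := by
      rw [← Finset.coe_inj, hxy]
      simp
    have hx' : Fin.castAdd b ⟨x, hx⟩ = x := rfl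
    have hy' : Fin.natAdd a ⟨y - a, by omega⟩ = y := Fin.ext (by simp; omega)
    exact ⟨⟨x, hx⟩, ⟨y - a, by omega⟩, by rwa [hx', hy'], by rw [hx', hy']⟩
  · rintro ⟨x, y, hs, rfl⟩
    exact ⟨(hN _).2 ⟨Fin.castAdd b x, Fin.natAdd a y, by simp, by simp, by simp⟩, hs⟩

theorem content_append {a b : ℕ} (f : Fin a → ℕ+) (g : Fin b → ℕ+) :
    content (Fin.append f g) = content f + content g := by
  simp [content, Fin.sum_univ_add]

theorem Matroid.qsym_eq_mul {a b : ℕ} {M₁ : Matroid (Fin a)} {M₂ : Matroid (Fin b)}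
    {N : Matroid (Fin (a + b))} (h₁ : ∀ B, M₁.IsBase B ↔ ∃ x, B = {x})
    (h₂ : ∀ B, M₂.IsBase B ↔ ∃ x, B = {x})
    (hN : ∀ B, N.IsBase B ↔ ∃ x y : Fin (a + b), x < a ∧ a ≤ y ∧ B = {x, y}) :
    N.qsym = M₁.qsym * M₂.qsym := by
  classical
  apply QSym.ext_coeff
  intro d
  rw [Subalgebra.coe_mul, MvPowerSeries.coeff_mul]
  simp only [Matroid.coeff_qsym, Finset.sum_mul_sum]
  simp only [← Finset.sum_product', Finset.sum_sigma']
  symm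
  refine Finset.sum_nbij' (fun p => Fin.append p.2.1 p.2.2)
    (fun h => ⟨(content fun i => h (Fin.castAdd b i), content fun i => h (Fin.natAdd a i)),
      (fun i => h (Fin.castAdd b i), fun i => h (Fin.natAdd a i))⟩) ?_ ?_ ?_ ?_ ?_
  · rintro ⟨⟨p, q⟩, f, g⟩ h
    simp only [Finset.mem_sigma, Finset.mem_product, mem_fillings,
      Finset.HasAntidiagonal.mem_antidiagonal] at h ⊢
    rw [content_append, h.2.1, h.2.2, h.1]
  · intro h hh
    simp only [Finset.mem_sigma, Finset.mem_product, mem_fillings,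
      Finset.HasAntidiagonal.mem_antidiagonal, and_true] at hh ⊢
    rw [← content_append, Fin.append_castAdd_natAdd, hh]
  · rintro ⟨⟨p, q⟩, f, g⟩ h
    simp only [Finset.mem_sigma, Finset.mem_product, mem_fillings] at h
    obtain ⟨-, rfl, rfl⟩ := h
    simp
  · intro h _
    exact Fin.append_castAdd_natAdd
  · rintro ⟨⟨p, q⟩, f, g⟩ _
    rw [card_strictBases_of_pairs hN, card_strictBases_of_rank_one h₁,
      card_strictBases_of_rank_one h₂, Nat.cast_mul]

theorem QSym.mul_mem_maxIdeal_sq {f g : QSym} {k m : ℕ} (hk : 1 ≤ k) (hm : 1 ≤ m)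
    (hf : QSym.IsHomogeneous f k) (hg : QSym.IsHomogeneous g m) : f * g ∈ QSym.maxIdeal ^ 2 := by
  rw [pow_two]
  exact Ideal.mul_mem_mul (Ideal.subset_span ⟨k, hk, hf⟩) (Ideal.subset_span ⟨m, hm, hg⟩)

/-! ### Bases of the matroids `M_λ` -/

theorem rankTwoMatroid_indep_iff {n : ℕ} (c : Composition n) (I : Set (Fin n)) :
    (rankTwoMatroid c).Indep I ↔ I.ncard ≤ 2 ∧ Set.InjOn c.index I := by
  simp [rankTwoMatroid]

theorem Composition.index_surjective {n : ℕ} (c : Composition n) :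
    Function.Surjective c.index := fun k =>
  ⟨c.embedding k ⟨0, c.one_le_blocksFun k⟩, c.index_embedding k _⟩

theorem rankTwoMatroid_isBase_iff {n : ℕ} (c : Composition n) (hc : 2 ≤ c.length)
    (B : Set (Fin n)) : (rankTwoMatroid c).IsBase B ↔
      ∃ x y : Fin n, x < y ∧ c.index x ≠ c.index y ∧ B = {x, y} := by
  have hpair : ∀ x y : Fin n, c.index x ≠ c.index y → (rankTwoMatroid c).IsBase {x, y} := by
    intro x y hxy
    have hne : x ≠ y := fun h => hxy (h ▸ rfl)
    rw [Matroid.isBase_iff_maximal_indep]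
    refine ⟨(rankTwoMatroid_indep_iff _ _).2 ⟨(Set.ncard_pair hne).le, ?_⟩, fun J hJ h => ?_⟩
    · rintro u (rfl | rfl) v (rfl | rfl) huv <;> simp_all
    · rw [rankTwoMatroid_indep_iff] at hJ
      exact (Set.eq_of_subset_of_ncard_le h (by rw [Set.ncard_pair hne]; exact hJ.1)
        J.toFinite).ge
  constructor
  · intro hB
    obtain ⟨u, hu⟩ := c.index_surjective ⟨0, by omega⟩
    obtain ⟨v, hv⟩ := c.index_surjective ⟨1, by omega⟩
    have huv : c.index u ≠ c.index v := by simp [hu, hv]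
    have hcard := hB.ncard_eq_ncard_of_isBase (hpair u v huv)
    rw [Set.ncard_pair fun h => huv (congrArg _ h)] at hcard
    obtain ⟨x, y, hxy, rfl⟩ := Set.ncard_eq_two.1 hcard
    have hinj := ((rankTwoMatroid_indep_iff _ _).1 hB.indep).2
    have hne : c.index x ≠ c.index y := fun h => hxy (hinj (by simp) (by simp) h)
    rcases lt_or_gt_of_ne hxy with h | h
    · exact ⟨x, y, h, hne, rfl⟩
    · exact ⟨y, x, h, hne.symm, Set.pair_comm _ _⟩
  · rintro ⟨x, y, -, hne, rfl⟩
    exact hpair x y hne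

theorem rankTwoMatroid_single_isBase_iff {n : ℕ} (hn : 0 < n) (B : Set (Fin n)) :
    (rankTwoMatroid (Composition.single n hn)).IsBase B ↔ ∃ x, B = {x} := by
  have hindep : ∀ I, (rankTwoMatroid (Composition.single n hn)).Indep I ↔ I.Subsingleton := by
    intro I
    rw [rankTwoMatroid_indep_iff]
    constructor
    · intro h x hx y hy
      refine h.2 hx hy (Fin.ext ?_)
      have h1 := ((Composition.single n hn).index x).isLt
      have h2 := ((Composition.single n hn).index y).isLt
      have h3 := Composition.single_length hn
      omega
    · intro h
      exact ⟨((Set.ncard_le_one I.toFinite).2 fun x hx y hy => h hx hy).trans (by norm_num),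
        h.injOn _⟩
  have hsingle : ∀ x, (rankTwoMatroid (Composition.single n hn)).IsBase {x} := by
    intro x
    rw [Matroid.isBase_iff_maximal_indep]
    refine ⟨(hindep _).2 Set.subsingleton_singleton, fun J hJ h y hy => ?_⟩
    exact (hindep J).1 hJ hy (h rfl)
  constructor
  · intro hB
    have := hB.ncard_eq_ncard_of_isBase (hsingle ⟨0, hn⟩)
    rw [Set.ncard_singleton] at this
    exact Set.ncard_eq_one.1 this
  · rintro ⟨x, rfl⟩
    exact hsingle x

theorem isPairSplit_rankTwoMatroid {n : ℕ} {lam α β μ : Composition n} {s a b : ℕ}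
    (hs : 1 ≤ s) (hst : s < lam.length) (ha : a = (lam.blocks.take s).sum)
    (hα : α.blocks = a :: lam.blocks.drop s) (hβ : β.blocks = lam.blocks.take s ++ [b])
    (hμ : μ.blocks = [a, b]) :
    IsPairSplit a (rankTwoMatroid lam) (rankTwoMatroid α) (rankTwoMatroid β)
      (rankTwoMatroid μ) := by
  have hlamlen : lam.blocks.length = lam.length := lam.blocks_length
  have hαlen : 2 ≤ α.length := by
    rw [← α.blocks_length, hα, List.length_cons, List.length_drop]
    omega
  have hβlen : 2 ≤ β.length := by
    rw [← β.blocks_length, hβ, List.length_append, List.length_take, List.length_singleton]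
    omega
  have hμlen : μ.length = 2 := by
    rw [← μ.blocks_length, hμ]
    rfl
  have hlen : ((lam.blocks.take s).length) = s := by
    rw [List.length_take]
    omega
  have haS : a = lam.sizeUpTo s := ha
  have hαS : ∀ k, α.sizeUpTo (k + 1) = lam.sizeUpTo (s + k) := by
    intro k
    rw [Composition.sizeUpTo, Composition.sizeUpTo, hα, List.take_succ_cons, List.sum_cons,
      List.take_add, List.sum_append, ha]
  have hβS : ∀ k, k ≤ s → β.sizeUpTo k = lam.sizeUpTo k := by
    intro k hk
    rw [Composition.sizeUpTo, Composition.sizeUpTo, hβ, List.take_append_of_le_length (by omega),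
      List.take_take, min_eq_left hk]
  have hβS' : ∀ k, s < k → β.sizeUpTo k = n := by
    intro k hk
    refine β.sizeUpTo_ofLength_le k ?_
    rw [← β.blocks_length, hβ, List.length_append, hlen, List.length_singleton]
    omega
  have sepα : ∀ x y : Fin n, x < y → (α.index x ≠ α.index y ↔
      ∃ k, s ≤ k ∧ (x : ℕ) < lam.sizeUpTo k ∧ lam.sizeUpTo k ≤ y) := by
    intro x y hxy
    rw [α.index_ne_iff hxy]
    constructor
    · rintro ⟨k, hk, hk'⟩
      cases k with
      | zero => simp at hk
      | succ k =>
        rw [hαS] at hk hk'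
        exact ⟨s + k, by omega, hk, hk'⟩
    · rintro ⟨k, hsk, hk, hk'⟩
      obtain ⟨k, rfl⟩ := Nat.exists_eq_add_of_le hsk
      exact ⟨k + 1, by rwa [hαS], by rwa [hαS]⟩
  have sepβ : ∀ x y : Fin n, x < y → (β.index x ≠ β.index y ↔
      ∃ k, k ≤ s ∧ (x : ℕ) < lam.sizeUpTo k ∧ lam.sizeUpTo k ≤ y) := by
    intro x y hxy
    rw [β.index_ne_iff hxy]
    constructor
    · rintro ⟨k, hk, hk'⟩
      rcases le_or_gt k s with hks | hks
      · rw [hβS k hks] at hk hk'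
        exact ⟨k, hks, hk, hk'⟩
      · rw [hβS' k hks] at hk'
        omega
    · rintro ⟨k, hks, hk, hk'⟩
      exact ⟨k, by rwa [hβS k hks], by rwa [hβS k hks]⟩
  have sepμ : ∀ x y : Fin n, x < y → (μ.index x ≠ μ.index y ↔ (x : ℕ) < a ∧ a ≤ y) := by
    intro x y hxy
    rw [μ.index_ne_iff hxy]
    have h1 : μ.sizeUpTo 1 = a := by simp [Composition.sizeUpTo, hμ]
    constructor
    · rintro ⟨k, hk, hk'⟩
      match k with
      | 0 => simp at hk
      | 1 => rw [h1] at hk hk'; exact ⟨hk, hk'⟩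
      | k + 2 =>
        rw [μ.sizeUpTo_ofLength_le (k + 2) (by omega)] at hk'
        omega
    · rintro ⟨hx, hy⟩
      exact ⟨1, by rwa [h1], by rwa [h1]⟩
  have hmono : ∀ {i j}, i ≤ j → lam.sizeUpTo i ≤ lam.sizeUpTo j := fun h => lam.monotone_sizeUpTo h
  have hM := rankTwoMatroid_isBase_iff lam (by omega)
  have hM₁ := rankTwoMatroid_isBase_iff α hαlen
  have hM₂ := rankTwoMatroid_isBase_iff β hβlen
  have hN := rankTwoMatroid_isBase_iff μ hμlen.ge
  constructor
  · intro B
    rw [hM, hM₁, hM₂]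
    constructor
    · rintro ⟨x, y, hxy, hne, rfl⟩
      obtain ⟨k, hk, hk'⟩ := (lam.index_ne_iff hxy).1 hne
      rcases le_total s k with hsk | hsk
      · exact Or.inl ⟨x, y, hxy, (sepα x y hxy).2 ⟨k, hsk, hk, hk'⟩, rfl⟩
      · exact Or.inr ⟨x, y, hxy, (sepβ x y hxy).2 ⟨k, hsk, hk, hk'⟩, rfl⟩
    · rintro (⟨x, y, hxy, hne, rfl⟩ | ⟨x, y, hxy, hne, rfl⟩)
      · obtain ⟨k, -, hk⟩ := (sepα x y hxy).1 hne
        exact ⟨x, y, hxy, (lam.index_ne_iff hxy).2 ⟨k, hk⟩, rfl⟩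
      · obtain ⟨k, -, hk⟩ := (sepβ x y hxy).1 hne
        exact ⟨x, y, hxy, (lam.index_ne_iff hxy).2 ⟨k, hk⟩, rfl⟩
  · intro B hB
    obtain ⟨x, y, hxy, hne, rfl⟩ := (hM₁ B).1 hB
    obtain ⟨k, hsk, hk, hk'⟩ := (sepα x y hxy).1 hne
    exact ⟨x, y, hxy, haS.trans_le ((hmono hsk).trans hk'), rfl⟩
  · intro B hB
    obtain ⟨x, y, hxy, hne, rfl⟩ := (hM₂ B).1 hB
    obtain ⟨k, hsk, hk, hk'⟩ := (sepβ x y hxy).1 hne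
    exact ⟨x, y, hxy, (hk.trans_le (hmono hsk)).trans_eq haS.symm, rfl⟩
  · intro B
    rw [hN]
    constructor
    · rintro ⟨x, y, hxy, hne, rfl⟩
      exact ⟨x, y, ((sepμ x y hxy).1 hne).1, ((sepμ x y hxy).1 hne).2, rfl⟩
    · rintro ⟨x, y, hx, hy, rfl⟩
      have hxy : x < y := by rw [Fin.lt_def]; omega
      exact ⟨x, y, hxy, (sepμ x y hxy).2 ⟨hx, hy⟩, rfl⟩
  · intro B hB
    obtain ⟨x, y, hxy, hne, rfl⟩ := (hN B).1 hB
    have h := (sepμ x y hxy).1 hne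
    rw [haS] at h
    exact (hM₁ _).2 ⟨x, y, hxy, (sepα x y hxy).2 ⟨s, le_rfl, h⟩, rfl⟩
  · intro B hB
    obtain ⟨x, y, hxy, hne, rfl⟩ := (hN B).1 hB
    have h := (sepμ x y hxy).1 hne
    rw [haS] at h
    exact (hM₂ _).2 ⟨x, y, hxy, (sepβ x y hxy).2 ⟨s, le_rfl, h⟩, rfl⟩

/-! ### Base polytopes -/

/-- The linear functional `v ↦ ∑_{i < a} vᵢ`. -/
noncomputable def initialSum (n a : ℕ) : StrongDual ℝ (Fin n → ℝ) :=
  ∑ i ∈ Finset.univ.filter fun i : Fin n => (i : ℕ) < a, ContinuousLinearMap.proj i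

theorem initialSum_apply {n a : ℕ} (v : Fin n → ℝ) :
    initialSum n a v = ∑ i ∈ Finset.univ.filter fun i : Fin n => (i : ℕ) < a, v i := by
  simp [initialSum]

theorem initialSum_single {n a : ℕ} (x : Fin n) :
    initialSum n a (Pi.single x 1) = if (x : ℕ) < a then 1 else 0 := by
  rw [initialSum_apply, Finset.sum_pi_single']
  simp

theorem indicator_pair {n : ℕ} {x y : Fin n} (hxy : x ≠ y) :
    ({x, y} : Set (Fin n)).indicator (1 : Fin n → ℝ) = Pi.single x 1 + Pi.single y 1 := by
  funext i
  simp only [Set.indicator_apply, Set.mem_insert_iff, Set.mem_singleton_iff, Pi.one_apply,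
    Pi.add_apply, Pi.single_apply]
  by_cases hx : i = x
  · subst hx
    simp [hxy]
  · simp [hx]

theorem Matroid.indicator_mem_basePolytope {n : ℕ} {M : Matroid (Fin n)} {B : Set (Fin n)}
    (hB : M.IsBase B) : B.indicator 1 ∈ M.basePolytope :=
  subset_convexHull ℝ _ ⟨B, hB, rfl⟩

theorem Matroid.basePolytope_subset {n : ℕ} {M : Matroid (Fin n)} {C : Set (Fin n → ℝ)}
    (hC : Convex ℝ C) (h : ∀ B, M.IsBase B → B.indicator 1 ∈ C) : M.basePolytope ⊆ C :=
  convexHull_min (by rintro _ ⟨B, hB, rfl⟩; exact h B hB) hC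

theorem Matroid.basePolytope_mono {n : ℕ} {M M' : Matroid (Fin n)}
    (h : ∀ B, M.IsBase B → M'.IsBase B) : M.basePolytope ⊆ M'.basePolytope :=
  M.basePolytope_subset (convex_convexHull ℝ _) fun B hB => indicator_mem_basePolytope (h B hB)

theorem sum_mul_sum_smul_add {n a : ℕ} {v : Fin n → ℝ}
    (h₁ : ∑ i ∈ Finset.univ.filter fun i : Fin n => (i : ℕ) < a, v i = 1) (h₂ : ∑ i ∈ Finset.univ.filter fun i : Fin n => ¬ (i : ℕ) < a, v i = 1) :
    ∑ p ∈ (Finset.univ.filter fun i : Fin n => (i : ℕ) < a) ×ˢ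
      (Finset.univ.filter fun i : Fin n => ¬ (i : ℕ) < a),
        (v p.1 * v p.2) • (Pi.single p.1 1 + Pi.single p.2 1 : Fin n → ℝ) = v := by
  simp only [smul_add, Finset.sum_add_distrib]
  rw [Finset.sum_product, Finset.sum_product_right]
  simp only [← Finset.sum_smul, ← Finset.sum_mul, ← Finset.mul_sum, h₁, h₂, mul_one, one_mul]
  rw [Finset.sum_filter_add_sum_filter_not]
  funext j
  simp [Pi.single_apply]

namespace IsPairSplit

variable {n a : ℕ} {M M₁ M₂ N : Matroid (Fin n)}

theorem initialSum_le_one (h : IsPairSplit a M M₁ M₂ N) {v : Fin n → ℝ}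
    (hv : v ∈ M₁.basePolytope) : initialSum n a v ≤ 1 := by
  refine Matroid.basePolytope_subset (C := {v | initialSum n a v ≤ 1})
    (convex_halfSpace_le (initialSum n a).toLinearMap.isLinear 1) (fun B hB => ?_) hv
  obtain ⟨x, y, hxy, hy, rfl⟩ := h.left B hB
  change initialSum n a _ ≤ 1
  rw [indicator_pair hxy.ne, map_add, initialSum_single, initialSum_single,
    if_neg (not_lt.2 hy), add_zero]
  split_ifs <;> norm_num

theorem one_le_initialSum (h : IsPairSplit a M M₁ M₂ N) {v : Fin n → ℝ}
    (hv : v ∈ M₂.basePolytope) : 1 ≤ initialSum n a v := by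
  refine Matroid.basePolytope_subset (C := {v | 1 ≤ initialSum n a v})
    (convex_halfSpace_ge (initialSum n a).toLinearMap.isLinear 1) (fun B hB => ?_) hv
  obtain ⟨x, y, hxy, hx, rfl⟩ := h.right B hB
  change 1 ≤ initialSum n a _
  rw [indicator_pair hxy.ne, map_add, initialSum_single, initialSum_single, if_pos hx]
  split_ifs <;> norm_num

theorem initialSum_eq_one (h : IsPairSplit a M M₁ M₂ N) {v : Fin n → ℝ}
    (hv : v ∈ N.basePolytope) : initialSum n a v = 1 :=
  le_antisymm (h.initialSum_le_one (Matroid.basePolytope_mono h.inter_left hv))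
    (h.one_le_initialSum (Matroid.basePolytope_mono h.inter_right hv))

theorem nonneg_and_sum_eq_two (h : IsPairSplit a M M₁ M₂ N) {v : Fin n → ℝ}
    (hv : v ∈ M.basePolytope) : (∀ i, 0 ≤ v i) ∧ ∑ i, v i = 2 := by
  refine Matroid.basePolytope_subset (C := {v | (∀ i, 0 ≤ v i) ∧ ∑ i, v i = 2}) ?_ ?_ hv
  · rintro x ⟨hx, hx'⟩ y ⟨hy, hy'⟩ s t hs ht hst
    refine ⟨fun i => add_nonneg (mul_nonneg hs (hx i)) (mul_nonneg ht (hy i)), ?_⟩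
    simp only [Pi.add_apply, Pi.smul_apply, smul_eq_mul, Finset.sum_add_distrib,
      ← Finset.mul_sum, hx', hy', ← add_mul, hst, one_mul]
  · intro B hB
    refine ⟨fun i => Set.indicator_nonneg (fun _ _ => zero_le_one) i, ?_⟩
    obtain ⟨x, y, hxy, rfl⟩ : ∃ x y : Fin n, x < y ∧ B = {x, y} := by
      rcases (h.isBase_iff_or B).1 hB with hB | hB
      · obtain ⟨x, y, hxy, -, hB⟩ := h.left B hB
        exact ⟨x, y, hxy, hB⟩
      · obtain ⟨x, y, hxy, -, hB⟩ := h.right B hB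
        exact ⟨x, y, hxy, hB⟩
    rw [indicator_pair hxy.ne]
    simp only [Pi.add_apply, Finset.sum_add_distrib, Finset.sum_pi_single', Finset.mem_univ,
      if_true]
    norm_num

theorem mem_basePolytope_inter (h : IsPairSplit a M M₁ M₂ N) {v : Fin n → ℝ}
    (hv : v ∈ M.basePolytope) (hv₁ : initialSum n a v = 1) : v ∈ N.basePolytope := by
  obtain ⟨h0, h2⟩ := h.nonneg_and_sum_eq_two hv
  rw [initialSum_apply] at hv₁
  have hv₂ : ∑ i ∈ Finset.univ.filter fun i : Fin n => ¬ (i : ℕ) < a, v i = 1 := by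
    have := Finset.sum_filter_add_sum_filter_not Finset.univ (fun i : Fin n => (i : ℕ) < a) v
    linarith
  rw [← sum_mul_sum_smul_add hv₁ hv₂]
  refine (convex_convexHull ℝ _).sum_mem (fun p _ => mul_nonneg (h0 _) (h0 _)) ?_ ?_
  · rw [Finset.sum_product, ← Finset.sum_mul_sum, hv₁, hv₂, one_mul]
  · rintro ⟨x, y⟩ hp
    simp only [Finset.mem_product, Finset.mem_filter, Finset.mem_univ, true_and, not_lt] at hp
    have hne : x ≠ y := by rintro rfl; omega
    rw [← indicator_pair hne]
    exact Matroid.indicator_mem_basePolytope ((h.inter _).2 ⟨x, y, hp.1, hp.2, rfl⟩)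

theorem basePolytope_left_subset (h : IsPairSplit a M M₁ M₂ N) :
    M₁.basePolytope ⊆ M.basePolytope :=
  Matroid.basePolytope_mono fun B hB => (h.isBase_iff_or B).2 (Or.inl hB)

theorem basePolytope_right_subset (h : IsPairSplit a M M₁ M₂ N) :
    M₂.basePolytope ⊆ M.basePolytope :=
  Matroid.basePolytope_mono fun B hB => (h.isBase_iff_or B).2 (Or.inr hB)

theorem exists_mem_segment_inter (h : IsPairSplit a M M₁ M₂ N) {u v : Fin n → ℝ}
    (hu : u ∈ M.basePolytope) (hv : v ∈ M.basePolytope) (hu₁ : initialSum n a u ≤ 1)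
    (hv₁ : 1 ≤ initialSum n a v) : ∃ z ∈ segment ℝ u v, z ∈ N.basePolytope := by
  have hconn : IsPreconnected (segment ℝ u v) := (convex_segment u v).isPreconnected
  obtain ⟨z, hz, hz₁⟩ := hconn.intermediate_value (left_mem_segment ℝ u v)
    (right_mem_segment ℝ u v) (initialSum n a).continuous.continuousOn ⟨hu₁, hv₁⟩
  exact ⟨z, hz, h.mem_basePolytope_inter ((convex_convexHull ℝ _).segment_subset hu hv hz) hz₁⟩

theorem basePolytope_subset_union (h : IsPairSplit a M M₁ M₂ N) :
    M.basePolytope ⊆ M₁.basePolytope ∪ M₂.basePolytope := by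
  have hunion : M.basePolytope = convexHull ℝ (M₁.basePolytope ∪ M₂.basePolytope) := by
    refine Set.Subset.antisymm (Matroid.basePolytope_subset (convex_convexHull ℝ _) fun B hB => ?_)
      (convexHull_min (Set.union_subset h.basePolytope_left_subset h.basePolytope_right_subset)
        (convex_convexHull ℝ _))
    exact subset_convexHull ℝ _ (((h.isBase_iff_or B).1 hB).imp
      Matroid.indicator_mem_basePolytope Matroid.indicator_mem_basePolytope)
  have hN₁ : N.basePolytope ⊆ M₁.basePolytope := Matroid.basePolytope_mono h.inter_left
  have hN₂ : N.basePolytope ⊆ M₂.basePolytope := Matroid.basePolytope_mono h.inter_right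
  have hconv : ∀ M' : Matroid (Fin n), Convex ℝ M'.basePolytope := fun _ => convex_convexHull ℝ _
  have hne : ∀ M' : Matroid (Fin n), M'.basePolytope.Nonempty := fun M' =>
    M'.exists_isBase.elim fun B hB => ⟨_, Matroid.indicator_mem_basePolytope hB⟩
  intro w hw
  have hw' := hw
  rw [hunion, (hconv M₁).convexHull_union (hconv M₂) (hne M₁) (hne M₂), mem_convexJoin] at hw'
  obtain ⟨u, hu, v, hv, hwuv⟩ := hw'
  obtain ⟨z, hz, hzN⟩ := h.exists_mem_segment_inter (h.basePolytope_left_subset hu)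
    (h.basePolytope_right_subset hv) (h.initialSum_le_one hu) (h.one_le_initialSum hv)
  have hsub : segment ℝ u v ⊆ segment ℝ u z ∪ segment ℝ z v := by
    rw [segment_eq_image_lineMap] at hz
    obtain ⟨t, -, ht⟩ := hz
    rw [← insert_endpoints_openSegment]
    refine Set.insert_subset (Or.inl (left_mem_segment ℝ u z))
      (Set.insert_subset (Or.inr (right_mem_segment ℝ z v)) ?_)
    refine (openSegment_subset_union u v ⟨t, ht⟩).trans
      (Set.insert_subset (Or.inl (right_mem_segment ℝ u z)) ?_)
    exact Set.union_subset_union (openSegment_subset_segment ℝ u z)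
      (openSegment_subset_segment ℝ z v)
  rcases hsub hwuv with hw | hw
  · exact Or.inl ((hconv M₁).segment_subset hu (hN₁ hzN) hw)
  · exact Or.inr ((hconv M₂).segment_subset (hN₂ hzN) hv hw)

theorem basePolytope_inter (h : IsPairSplit a M M₁ M₂ N) :
    M₁.basePolytope ∩ M₂.basePolytope = N.basePolytope := by
  refine Set.Subset.antisymm (fun v hv => ?_) (Set.subset_inter
    (Matroid.basePolytope_mono h.inter_left) (Matroid.basePolytope_mono h.inter_right))
  exact h.mem_basePolytope_inter (h.basePolytope_left_subset hv.1)
    (le_antisymm (h.initialSum_le_one hv.1) (h.one_le_initialSum hv.2))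

theorem isExposed_left (h : IsPairSplit a M M₁ M₂ N) :
    IsExposed ℝ M₁.basePolytope N.basePolytope := by
  rintro ⟨z, hz⟩
  refine ⟨initialSum n a, Set.Subset.antisymm (fun v hv => ?_) fun v hv => ?_⟩
  · exact ⟨Matroid.basePolytope_mono h.inter_left hv, fun y hy =>
      (h.initialSum_le_one hy).trans_eq (h.initialSum_eq_one hv).symm⟩
  · refine h.mem_basePolytope_inter (h.basePolytope_left_subset hv.1)
      (le_antisymm (h.initialSum_le_one hv.1) ?_)
    rw [← h.initialSum_eq_one hz]
    exact hv.2 z (Matroid.basePolytope_mono h.inter_left hz)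

theorem isExposed_right (h : IsPairSplit a M M₁ M₂ N) :
    IsExposed ℝ M₂.basePolytope N.basePolytope := by
  rintro ⟨z, hz⟩
  refine ⟨-initialSum n a, Set.Subset.antisymm (fun v hv => ?_) fun v hv => ?_⟩
  · exact ⟨Matroid.basePolytope_mono h.inter_right hv, fun y hy =>
      neg_le_neg ((h.initialSum_eq_one hv).trans_le (h.one_le_initialSum hy))⟩
  · refine h.mem_basePolytope_inter (h.basePolytope_right_subset hv.1)
      (le_antisymm ?_ (h.one_le_initialSum hv.1))
    rw [← h.initialSum_eq_one hz]
    exact neg_le_neg_iff.1 (hv.2 z (Matroid.basePolytope_mono h.inter_right hz))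

theorem isSplit (h : IsPairSplit a M M₁ M₂ N) (hE : N.E = Set.univ) : M.IsSplit M₁ M₂ :=
  ⟨Set.Subset.antisymm h.basePolytope_subset_union
    (Set.union_subset h.basePolytope_left_subset h.basePolytope_right_subset),
    N, hE, h.isBase_inter_iff, h.basePolytope_inter, h.isExposed_left, h.isExposed_right⟩

end IsPairSplit

theorem proposition6p1 {n : ℕ} (lam α β μ : Composition n) (s a b : ℕ)
    (hs : 1 ≤ s) (hst : s < lam.length)
    (ha : a = (lam.blocks.take s).sum) (hb : b = (lam.blocks.drop s).sum)
    (hα : α.blocks = a :: lam.blocks.drop s)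
    (hβ : β.blocks = lam.blocks.take s ++ [b])
    (hμ : μ.blocks = [a, b]) :
    (rankTwoMatroid lam).qsym =
        (rankTwoMatroid α).qsym + (rankTwoMatroid β).qsym - (rankTwoMatroid μ).qsym ∧
      Ideal.Quotient.mk (QSym.maxIdeal ^ 2) (rankTwoMatroid lam).qsym =
        Ideal.Quotient.mk (QSym.maxIdeal ^ 2) (rankTwoMatroid α).qsym +
          Ideal.Quotient.mk (QSym.maxIdeal ^ 2) (rankTwoMatroid β).qsym ∧
      (rankTwoMatroid lam).IsSplit (rankTwoMatroid α) (rankTwoMatroid β) := by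
  have h := isPairSplit_rankTwoMatroid hs hst ha hα hβ hμ
  have ha0 : 0 < a := μ.blocks_pos (by simp [hμ])
  have hb0 : 0 < b := μ.blocks_pos (by simp [hμ])
  have hmem : (rankTwoMatroid μ).qsym ∈ QSym.maxIdeal ^ 2 := by
    obtain rfl : n = a + b := by simp [← μ.blocks_sum, hμ]
    rw [Matroid.qsym_eq_mul (rankTwoMatroid_single_isBase_iff ha0)
      (rankTwoMatroid_single_isBase_iff hb0) h.inter]
    exact QSym.mul_mem_maxIdeal_sq ha0 hb0 (Matroid.qsym_isHomogeneous _)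
      (Matroid.qsym_isHomogeneous _)
  refine ⟨h.qsym_eq, ?_, h.isSplit rfl⟩
  rw [h.qsym_eq, map_sub, map_add, Ideal.Quotient.eq_zero_iff_mem.2 hmem, sub_zero]
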